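/- Let $d\ge 1$ be an integer. For $k=\mathbb R$ or $k=\mathbb C$, let $\|\cdot\|$ denote the operator norm on $M_d(k)$ and on $M_d(\mathbb C)$ induced by the standard Euclidean (resp. Hermitian) norm. For a nonempty bounded set $Q\subset M_d(k)$ put $\|Q\|=\sup_{g\in Q}\|g\|$, let $Q^n$ be the set of all products of $n$ elements of $Q$ (with $Q^0=\{1\}$), and define the minimal norm and the spectral radius of $Q$ by $$E_k(Q)=\inf_{x\in GL_d(\mathbb C)}\|xQx^{-1}\|,\qquad R_k(Q)=\lim_{n\to\infty}\|Q^n\|^{1/n}.$$ There is a constant $c_1=c_1(d)>0$, depending only on $d$, such that for $k=\mathbb R$ or $\mathbb C$ and every bounded subset $Q\subset SL_d(k)$ containing $1$ the following hold. (1) For every integer $n\ge 0$, $\;E_k(Q^n)\ \ge\ E_k(Q)^{\sqrt{n/(8d)}}$. (2) The limit defining $R_k(Q)$ exists, and $\;\log R_k(Q)\ \ge\ c_1\cdot \log E_k(Q)\cdot\min\{1,\log E_k(Q)\}$. (3) $R_k(Q)=1$ if and only if $E_k(Q)=1$. -/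

import Mathlib

open scoped Pointwise

noncomputable section

namespace MinimalNorm

/-- The embedding `x ↦ re x + i im x` of the archimedean local field `k` (`ℝ` or `ℂ`) into its
algebraic closure `ℂ`: the usual inclusion for `k = ℝ`, the identity for `k = ℂ`. -/
def toComplex (k : Type*) [RCLike k] : k →+* ℂ where
  toFun x := ⟨RCLike.re x, RCLike.im x⟩
  map_zero' := by apply Complex.ext <;> simp
  map_one' := by apply Complex.ext <;> simp
  map_add' x y := by apply Complex.ext <;> simp
  map_mul' x y := by apply Complex.ext <;> simp [add_comm]

theorem toComplex_real (x : ℝ) : toComplex ℝ x = (x : ℂ) := by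
  apply Complex.ext <;> simp [toComplex]

theorem toComplex_complex (z : ℂ) : toComplex ℂ z = z := by
  apply Complex.ext <;> simp [toComplex]

theorem norm_toComplex {k : Type*} [RCLike k] (x : k) : ‖toComplex k x‖ = ‖x‖ := by
  have h : ‖toComplex k x‖ ^ 2 = ‖x‖ ^ 2 := by
    rw [Complex.sq_norm, Complex.normSq_apply, RCLike.norm_sq_eq_def]
    rfl
  exact (pow_left_inj₀ (norm_nonneg _) (norm_nonneg _) two_ne_zero).1 h

variable {d : ℕ} {k : Type*} [RCLike k]

/-- The operator norm of a matrix acting on `k ^ d` with its standard Euclidean (resp. Hermitian)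
norm. -/
def opNorm (g : Matrix (Fin d) (Fin d) k) : ℝ :=
  ‖Matrix.toEuclideanCLM (n := Fin d) (𝕜 := k) g‖

/-- `Q` is a bounded set of matrices. -/
def IsBoundedSet (Q : Set (Matrix (Fin d) (Fin d) k)) : Prop :=
  BddAbove (opNorm '' Q)

/-- The norm `‖Q‖ = sup_{g ∈ Q} ‖g‖` of a (nonempty bounded) set of matrices. -/
def setNorm (Q : Set (Matrix (Fin d) (Fin d) k)) : ℝ :=
  sSup (opNorm '' Q)

/-- The set `x Q x⁻¹` of complex matrices, for `x ∈ GL_d(ℂ)`. -/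
def conjSet (x : GL (Fin d) ℂ) (Q : Set (Matrix (Fin d) (Fin d) k)) :
    Set (Matrix (Fin d) (Fin d) ℂ) :=
  (fun q => (x : Matrix (Fin d) (Fin d) ℂ) * q.map (toComplex k) *
    ((x⁻¹ : GL (Fin d) ℂ) : Matrix (Fin d) (Fin d) ℂ)) '' Q

/-- The minimal norm `E_k(Q) = inf_{x ∈ GL_d(k̄)} ‖x Q x⁻¹‖`, where `k̄ = ℂ`. -/
def minimalNorm (Q : Set (Matrix (Fin d) (Fin d) k)) : ℝ :=
  ⨅ x : GL (Fin d) ℂ, setNorm (conjSet x Q)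

/-- The sequence `‖Q ^ n‖ ^ (1 / n)`, where `Q ^ n` is the set of products of `n` elements
of `Q`. -/
def rootNormSeq (Q : Set (Matrix (Fin d) (Fin d) k)) (n : ℕ) : ℝ :=
  setNorm (Q ^ n) ^ (1 / (n : ℝ))

/-- The spectral radius `R_k(Q) = lim_{n → ∞} ‖Q ^ n‖ ^ (1 / n)` of a set of matrices. -/
def jointSpectralRadius (Q : Set (Matrix (Fin d) (Fin d) k)) : ℝ :=
  Filter.limUnder Filter.atTop (rootNormSeq Q)

end MinimalNorm

end

/-! ### Second moments of a region and their distortion under linear self-maps. -/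

section BodyForm

open MeasureTheory Matrix
open scoped ComplexOrder

variable {d : ℕ}

/-! Everything follows from a linear bound `E(Q) ^ (n / (d + 1)) ≤ E(Q ^ n)`, stronger than the
square-root growth required. Given `S = x Q x⁻¹`, let `F(u)` be the product over `l < n` of `sup ‖wᴴ
u‖`, `w ∈ S ^ l`. Replacing `u` by `sᴴ u` with `s ∈ S` shifts every factor by one, so the product
telescopes and `F(sᴴ u) ≤ ‖S ^ n‖ F(u)`. As `F` is homogeneous of degree `n`, the region `F ≤ 1` is
carried into itself by `r⁻¹ sᴴ`, where `r = ‖S ^ n‖ ^ (1 / n)`. The region need not be convex, but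
its second moments define a Hermitian norm. Change of variables shows that the adjoint of a linear
self-map `t` of the region expands this norm by at most `|det t|⁻¹`, here `r ^ d`. Hence a single
conjugation makes every `s` of norm at most `r ^ (d + 1)` (`exists_opNorm_conj_le`). The infimum
over `x` gives the linear bound, and `n → ∞` gives `E ^ (1 / (d + 1)) ≤ R ≤ E`. -/

/-- The matrix of second moments of a region of `ℂ ^ d`. -/
noncomputable def momentMatrix (B : Set (Fin d → ℂ)) : Matrix (Fin d) (Fin d) ℂ :=
  Matrix.of fun i j => ∫ u in B, u i * star (u j)

theorem integrableOn_of_bounded_region {E : Type*} [NormedAddCommGroup E]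
    {B : Set (Fin d → ℂ)} (hb : Bornology.IsBounded B)
    {f : (Fin d → ℂ) → E} (hf : Continuous f) : IntegrableOn f B :=
  (hf.continuousOn.integrableOn_compact hb.isCompact_closure).mono_set subset_closure

/-- Expand the squared modulus as a double sum and integrate termwise; boundedness of the region
supplies integrability. -/
theorem dotProduct_momentMatrix_mulVec {B : Set (Fin d → ℂ)} (hb : Bornology.IsBounded B)
    (ξ : Fin d → ℂ) :
    star ξ ⬝ᵥ (momentMatrix B *ᵥ ξ) = ((∫ u in B, ‖star ξ ⬝ᵥ u‖ ^ 2 : ℝ) : ℂ) := by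
  have h1 : ∀ u : Fin d → ℂ, ((‖star ξ ⬝ᵥ u‖ ^ 2 : ℝ) : ℂ) =
      ∑ i, ∑ j, star (ξ i) * (u i * star (u j) * ξ j) := by
    intro u
    have : ((‖star ξ ⬝ᵥ u‖ ^ 2 : ℝ) : ℂ) = (star ξ ⬝ᵥ u) * star (star ξ ⬝ᵥ u) := by
      rw [Complex.star_def, Complex.mul_conj, Complex.normSq_eq_norm_sq]
    rw [this, dotProduct, star_sum, Finset.sum_mul_sum]
    refine Finset.sum_congr rfl fun i _ => Finset.sum_congr rfl fun j _ => ?_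
    simp only [Pi.star_apply, star_mul', star_star]
    ring
  rw [← integral_complex_ofReal]
  simp_rw [h1]
  rw [integral_finsetSum]
  · simp only [dotProduct, mulVec, Pi.star_apply, Finset.mul_sum]
    refine Finset.sum_congr rfl fun i _ => ?_
    rw [integral_finsetSum]
    · refine Finset.sum_congr rfl fun j _ => ?_
      rw [integral_const_mul, integral_mul_const]
      rfl
    · intro j _
      exact integrableOn_of_bounded_region hb (by fun_prop)
  · intro i _
    exact integrableOn_of_bounded_region hb (by fun_prop)

theorem momentMatrix_posDef {B : Set (Fin d → ℂ)} (hb : Bornology.IsBounded B)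
    (h0 : B ∈ nhds 0) : (momentMatrix B).PosDef := by
  refine .of_dotProduct_mulVec_pos ?_ fun ξ hξ => ?_
  · ext i j
    simp only [conjTranspose_apply, momentMatrix, of_apply]
    rw [Complex.star_def, ← integral_conj]
    simp [mul_comm]
  · rw [dotProduct_momentMatrix_mulVec hb]
    rw [Complex.zero_lt_real]
    have hc : Continuous fun u : Fin d → ℂ => ‖star ξ ⬝ᵥ u‖ ^ 2 := by
      unfold dotProduct; fun_prop
    rw [setIntegral_pos_iff_support_of_nonneg_ae (ae_of_all _ fun u => by positivity)
      (integrableOn_of_bounded_region hb hc)]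
    obtain ⟨U, hUB, hU, h0U⟩ := mem_nhds_iff.1 h0
    have hs : IsOpen (Function.support (fun u : Fin d → ℂ => ‖star ξ ⬝ᵥ u‖ ^ 2)) :=
      hc.isOpen_support
    refine lt_of_lt_of_le ((hs.inter hU).measure_pos volume ?_)
      (measure_mono (Set.inter_subset_inter_right _ hUB))
    -- A small nonzero multiple of `ξ` lies in the region, and the integrand is positive there.
    have ht : Filter.Tendsto (fun t : ℝ => (t : ℂ) • ξ) (nhdsWithin 0 {0}ᶜ) (nhds 0) := by
      have : Continuous fun t : ℝ => (t : ℂ) • ξ := by fun_prop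
      have := this.tendsto 0
      simp only [Complex.ofReal_zero, zero_smul] at this
      exact this.mono_left nhdsWithin_le_nhds
    obtain ⟨t, htU, ht0⟩ := ((ht.eventually (hU.mem_nhds h0U)).and self_mem_nhdsWithin).exists
    refine ⟨(t : ℂ) • ξ, ?_, htU⟩
    have hne : star ξ ⬝ᵥ ξ ≠ 0 := by
      rwa [Ne, dotProduct_star_self_eq_zero]
    have ht0' : t ≠ 0 := ht0
    simp [dotProduct_smul, hne, ht0']

/-- The Jacobian of a complex-linear map over `ℝ` is the norm from `ℂ` to `ℝ` of its complex
determinant. The square cancels against the squared Hermitian norm. -/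
theorem abs_det_mulVecLin_restrictScalars (t : Matrix (Fin d) (Fin d) ℂ) :
    |(t.mulVecLin.restrictScalars ℝ).det| = ‖t.det‖ ^ 2 := by
  rw [LinearMap.det_restrictScalars, Algebra.norm_complex_apply, ← Matrix.toLin'_apply',
    LinearMap.det_toLin', Complex.normSq_eq_norm_sq, abs_of_nonneg (by positivity)]

open scoped MatrixOrder Matrix.Norms.L2Operator in
theorem exists_isUnit_eq_conjTranspose_mul_self {M : Matrix (Fin d) (Fin d) ℂ} (hM : M.PosDef) :
    ∃ y : Matrix (Fin d) (Fin d) ℂ, IsUnit y ∧ M = yᴴ * y :=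
  CStarAlgebra.isStrictlyPositive_iff_eq_star_mul_self.mp (isStrictlyPositive_iff_posDef.2 hM)

/-- A bounded neighbourhood of the origin in `ℂ ^ d` determines a Hermitian norm which is distorted
by a linear map of the region into itself only as much as the map contracts volumes. -/
theorem exists_norm_conjTranspose_mulVec_le {B : Set (Fin d → ℂ)} (hB : MeasurableSet B)
    (hb : Bornology.IsBounded B) (h0 : B ∈ nhds 0) :
    ∃ y : GL (Fin d) ℂ, ∀ t : Matrix (Fin d) (Fin d) ℂ, t.det ≠ 0 →
      (∀ u ∈ B, t *ᵥ u ∈ B) → ∀ ξ : Fin d → ℂ,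
        ‖WithLp.toLp 2 (y.1 *ᵥ (tᴴ *ᵥ ξ))‖ ≤ ‖t.det‖⁻¹ * ‖WithLp.toLp 2 (y.1 *ᵥ ξ)‖ := by
  obtain ⟨y, hy, hΓ⟩ := exists_isUnit_eq_conjTranspose_mul_self (momentMatrix_posDef hb h0)
  have key : ∀ ξ : Fin d → ℂ, ‖WithLp.toLp 2 (y *ᵥ ξ)‖ ^ 2 = ∫ u in B, ‖star ξ ⬝ᵥ u‖ ^ 2 := by
    intro ξ
    have h := dotProduct_momentMatrix_mulVec hb ξ
    rw [hΓ, ← mulVec_mulVec, dotProduct_mulVec, vecMul_conjTranspose,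
      star_star] at h
    have h2 : star (y *ᵥ ξ) ⬝ᵥ (y *ᵥ ξ) = ((‖WithLp.toLp 2 (y *ᵥ ξ)‖ ^ 2 : ℝ) : ℂ) := by
      rw [EuclideanSpace.norm_sq_eq]
      simp [dotProduct, Complex.conj_mul']
    rw [h2] at h
    exact_mod_cast h
  refine ⟨hy.unit, fun t ht hmap ξ => ?_⟩
  rw [IsUnit.unit_spec]
  refine (sq_le_sq₀ (by positivity) (by positivity)).1 ?_
  rw [mul_pow, inv_pow, key, key, ← div_eq_inv_mul, le_div_iff₀ (by positivity), mul_comm,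
    ← abs_det_mulVecLin_restrictScalars]
  let f : (Fin d → ℂ) →L[ℝ] (Fin d → ℂ) :=
    LinearMap.toContinuousLinearMap (t.mulVecLin.restrictScalars ℝ)
  have hf : ∀ u, f u = t *ᵥ u := fun u => rfl
  have hinj : Function.Injective f :=
    Matrix.mulVec_injective_of_isUnit ((Matrix.isUnit_iff_isUnit_det t).2 ht.isUnit)
  -- The integral over the image `t B` is at most that over `B`, since `t B ⊆ B` and the integrand
  -- is nonnegative.
  have hcv := integral_image_eq_integral_abs_det_fderiv_smul volume hB
    (fun u _ => f.hasFDerivWithinAt) hinj.injOn (fun u => ‖star ξ ⬝ᵥ u‖ ^ 2)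
  have hadj : ∀ u, star (tᴴ *ᵥ ξ) ⬝ᵥ u = star ξ ⬝ᵥ f u := by
    intro u
    rw [hf, star_mulVec, conjTranspose_conjTranspose, dotProduct_mulVec]
  simp_rw [hadj]
  rw [integral_smul, smul_eq_mul] at hcv
  refine hcv.symm.trans_le (setIntegral_mono_set
    (integrableOn_of_bounded_region hb (by unfold dotProduct; fun_prop))
    (ae_of_all _ fun u => by positivity) (LE.le.eventuallyLE ?_))
  rintro _ ⟨u, hu, rfl⟩
  exact hmap u hu

end BodyForm

namespace MinimalNorm

open Matrix Filter Topology

/-! ### Operator norms of matrices and of bounded sets. -/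

section Norms

variable {d : ℕ} {k : Type*} [RCLike k]

theorem opNorm_nonneg (g : Matrix (Fin d) (Fin d) k) : 0 ≤ opNorm g := norm_nonneg _

theorem opNorm_mul_le (g h : Matrix (Fin d) (Fin d) k) : opNorm (g * h) ≤ opNorm g * opNorm h := by
  unfold opNorm
  rw [map_mul]
  exact norm_mul_le _ _

theorem opNorm_one [NeZero d] : opNorm (1 : Matrix (Fin d) (Fin d) k) = 1 := by
  unfold opNorm
  rw [map_one]
  exact norm_one

theorem opNorm_conjTranspose (g : Matrix (Fin d) (Fin d) k) : opNorm gᴴ = opNorm g := by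
  unfold opNorm
  rw [← star_eq_conjTranspose, map_star]
  exact ContinuousLinearMap.adjoint.norm_map _

theorem norm_mulVec_le (g : Matrix (Fin d) (Fin d) k) (u : Fin d → k) :
    ‖WithLp.toLp 2 (g *ᵥ u)‖ ≤ opNorm g * ‖WithLp.toLp 2 u‖ :=
  (toEuclideanCLM (n := Fin d) (𝕜 := k) g).le_opNorm (WithLp.toLp 2 u)

theorem opNorm_le_of_norm_mulVec_le {g : Matrix (Fin d) (Fin d) k} {C : ℝ} (hC : 0 ≤ C)
    (h : ∀ u : Fin d → k, ‖WithLp.toLp 2 (g *ᵥ u)‖ ≤ C * ‖WithLp.toLp 2 u‖) : opNorm g ≤ C :=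
  ContinuousLinearMap.opNorm_le_bound _ hC fun u => h u.ofLp

theorem norm_apply_le_opNorm (g : Matrix (Fin d) (Fin d) k) (i j : Fin d) :
    ‖g i j‖ ≤ opNorm g := by
  have h := norm_mulVec_le g (Pi.single j 1)
  rw [mulVec_single_one, PiLp.toLp_single, PiLp.norm_single, norm_one, mul_one] at h
  exact (PiLp.norm_apply_le (WithLp.toLp 2 (g.col j)) i).trans h

theorem opNorm_le_sum (g : Matrix (Fin d) (Fin d) k) : opNorm g ≤ ∑ i, ∑ j, ‖g i j‖ := by
  refine opNorm_le_of_norm_mulVec_le (by positivity) fun u => ?_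
  have h1 : ‖WithLp.toLp 2 (g *ᵥ u)‖ ≤ ∑ i, ‖(g *ᵥ u) i‖ := by
    have : WithLp.toLp 2 (g *ᵥ u) = ∑ i, WithLp.toLp 2 (Pi.single i ((g *ᵥ u) i)) := by
      rw [← WithLp.toLp_sum, Finset.univ_sum_single]
    rw [this]
    refine (norm_sum_le _ _).trans (Finset.sum_le_sum fun i _ => ?_)
    rw [PiLp.toLp_single, PiLp.norm_single]
  refine h1.trans ?_
  rw [Finset.sum_mul]
  refine Finset.sum_le_sum fun i _ => ?_
  rw [Finset.sum_mul]
  refine (norm_sum_le Finset.univ fun j => g i j * u j).trans (Finset.sum_le_sum fun j _ => ?_)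
  rw [norm_mul]
  exact mul_le_mul_of_nonneg_left (PiLp.norm_apply_le (WithLp.toLp 2 u) j) (norm_nonneg _)

/-- A crude comparison suffices for passing between `k` and `ℂ`: the factor `d ^ 2` disappears under
`n`-th roots. -/
theorem opNorm_le_of_norm_apply_le {l : Type*} [RCLike l] (g : Matrix (Fin d) (Fin d) k)
    (h : Matrix (Fin d) (Fin d) l) (hgh : ∀ i j, ‖g i j‖ ≤ ‖h i j‖) :
    opNorm g ≤ (d : ℝ) ^ 2 * opNorm h := by
  refine (opNorm_le_sum g).trans ((Finset.sum_le_sum fun i _ => Finset.sum_le_sum fun j _ =>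
    (hgh i j).trans (norm_apply_le_opNorm h i j)).trans_eq ?_)
  simp [sq, mul_assoc]

theorem opNorm_map_le (g : Matrix (Fin d) (Fin d) k) :
    opNorm (g.map (toComplex k)) ≤ (d : ℝ) ^ 2 * opNorm g :=
  opNorm_le_of_norm_apply_le _ _ fun i j => (norm_toComplex (g i j)).le

theorem opNorm_le_map (g : Matrix (Fin d) (Fin d) k) :
    opNorm g ≤ (d : ℝ) ^ 2 * opNorm (g.map (toComplex k)) :=
  opNorm_le_of_norm_apply_le _ _ fun i j => (norm_toComplex (g i j)).ge

theorem setNorm_nonneg (S : Set (Matrix (Fin d) (Fin d) k)) : 0 ≤ setNorm S :=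
  Real.sSup_nonneg (by rintro _ ⟨g, _, rfl⟩; exact opNorm_nonneg g)

theorem opNorm_le_setNorm {S : Set (Matrix (Fin d) (Fin d) k)} (hS : IsBoundedSet S)
    {g : Matrix (Fin d) (Fin d) k} (hg : g ∈ S) : opNorm g ≤ setNorm S :=
  le_csSup hS (Set.mem_image_of_mem _ hg)

theorem setNorm_le {S : Set (Matrix (Fin d) (Fin d) k)} {C : ℝ} (hC : 0 ≤ C)
    (h : ∀ g ∈ S, opNorm g ≤ C) : setNorm S ≤ C :=
  Real.sSup_le (by rintro _ ⟨g, hg, rfl⟩; exact h g hg) hC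

theorem IsBoundedSet.of_le {S : Set (Matrix (Fin d) (Fin d) k)} {C : ℝ}
    (h : ∀ g ∈ S, opNorm g ≤ C) : IsBoundedSet S :=
  ⟨C, by rintro _ ⟨g, hg, rfl⟩; exact h g hg⟩

theorem opNorm_mul_le_setNorm {S T : Set (Matrix (Fin d) (Fin d) k)} (hS : IsBoundedSet S)
    (hT : IsBoundedSet T) : ∀ g ∈ S * T, opNorm g ≤ setNorm S * setNorm T := by
  rintro _ ⟨a, ha, b, hb, rfl⟩
  exact (opNorm_mul_le a b).trans (mul_le_mul (opNorm_le_setNorm hS ha) (opNorm_le_setNorm hT hb)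
    (opNorm_nonneg b) (setNorm_nonneg S))

theorem IsBoundedSet.mul {S T : Set (Matrix (Fin d) (Fin d) k)} (hS : IsBoundedSet S)
    (hT : IsBoundedSet T) : IsBoundedSet (S * T) :=
  .of_le (opNorm_mul_le_setNorm hS hT)

theorem setNorm_mul_le {S T : Set (Matrix (Fin d) (Fin d) k)} (hS : IsBoundedSet S)
    (hT : IsBoundedSet T) : setNorm (S * T) ≤ setNorm S * setNorm T :=
  setNorm_le (mul_nonneg (setNorm_nonneg S) (setNorm_nonneg T)) (opNorm_mul_le_setNorm hS hT)

theorem isBoundedSet_one : IsBoundedSet (1 : Set (Matrix (Fin d) (Fin d) k)) :=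
  .of_le (C := opNorm (1 : Matrix (Fin d) (Fin d) k)) (by rintro _ rfl; rfl)

theorem IsBoundedSet.pow {S : Set (Matrix (Fin d) (Fin d) k)} (hS : IsBoundedSet S) (n : ℕ) :
    IsBoundedSet (S ^ n) := by
  induction n with
  | zero => rw [pow_zero]; exact isBoundedSet_one
  | succ n ih => rw [pow_succ]; exact ih.mul hS

theorem setNorm_one [NeZero d] : setNorm (1 : Set (Matrix (Fin d) (Fin d) k)) = 1 := by
  simp [setNorm, opNorm_one]

theorem setNorm_pow_le [NeZero d] {S : Set (Matrix (Fin d) (Fin d) k)} (hS : IsBoundedSet S)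
    (n : ℕ) : setNorm (S ^ n) ≤ setNorm S ^ n := by
  induction n with
  | zero => rw [pow_zero, pow_zero, setNorm_one]
  | succ n ih =>
    rw [pow_succ, pow_succ]
    exact (setNorm_mul_le (hS.pow n) hS).trans
      (mul_le_mul_of_nonneg_right ih (setNorm_nonneg S))

theorem setNorm_mono {S T : Set (Matrix (Fin d) (Fin d) k)} (hT : IsBoundedSet T) (h : S ⊆ T) :
    setNorm S ≤ setNorm T :=
  setNorm_le (setNorm_nonneg T) fun _ hg => opNorm_le_setNorm hT (h hg)

theorem one_le_setNorm [NeZero d] {S : Set (Matrix (Fin d) (Fin d) k)} (hS : IsBoundedSet S)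
    (h1 : 1 ∈ S) : 1 ≤ setNorm S :=
  opNorm_one.symm.le.trans (opNorm_le_setNorm hS h1)

end Norms

/-! ### The telescoping product of orbit norms and the invariant region. -/

section OrbitNorm

variable {d : ℕ}

/-- The largest Euclidean norm of a vector in the orbit of `u` under the adjoints of the elements
of `S`. -/
noncomputable def orbitNorm (S : Set (Matrix (Fin d) (Fin d) ℂ)) (u : Fin d → ℂ) : ℝ :=
  sSup ((fun w : Matrix (Fin d) (Fin d) ℂ => ‖WithLp.toLp 2 (wᴴ *ᵥ u)‖) '' S)

variable {S : Set (Matrix (Fin d) (Fin d) ℂ)}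

theorem orbitNorm_nonneg (S : Set (Matrix (Fin d) (Fin d) ℂ)) (u : Fin d → ℂ) :
    0 ≤ orbitNorm S u :=
  Real.sSup_nonneg (by rintro _ ⟨w, _, rfl⟩; exact norm_nonneg _)

theorem orbitNorm_le {u : Fin d → ℂ} {C : ℝ} (hC : 0 ≤ C)
    (h : ∀ w ∈ S, ‖WithLp.toLp 2 (wᴴ *ᵥ u)‖ ≤ C) : orbitNorm S u ≤ C :=
  Real.sSup_le (by rintro _ ⟨w, hw, rfl⟩; exact h w hw) hC

theorem norm_conjTranspose_mulVec_le_setNorm (hS : IsBoundedSet S)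
    {w : Matrix (Fin d) (Fin d) ℂ} (hw : w ∈ S) (u : Fin d → ℂ) :
    ‖WithLp.toLp 2 (wᴴ *ᵥ u)‖ ≤ setNorm S * ‖WithLp.toLp 2 u‖ := by
  refine (norm_mulVec_le _ _).trans (mul_le_mul_of_nonneg_right ?_ (norm_nonneg _))
  rw [opNorm_conjTranspose]
  exact opNorm_le_setNorm hS hw

theorem norm_le_orbitNorm (hS : IsBoundedSet S) {w : Matrix (Fin d) (Fin d) ℂ} (hw : w ∈ S)
    (u : Fin d → ℂ) : ‖WithLp.toLp 2 (wᴴ *ᵥ u)‖ ≤ orbitNorm S u := by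
  refine le_csSup ⟨setNorm S * ‖WithLp.toLp 2 u‖, ?_⟩ (Set.mem_image_of_mem _ hw)
  rintro _ ⟨w, hw, rfl⟩
  exact norm_conjTranspose_mulVec_le_setNorm hS hw u

theorem orbitNorm_le_setNorm (hS : IsBoundedSet S) (u : Fin d → ℂ) :
    orbitNorm S u ≤ setNorm S * ‖WithLp.toLp 2 u‖ :=
  orbitNorm_le (mul_nonneg (setNorm_nonneg S) (norm_nonneg _)) fun _ hw =>
    norm_conjTranspose_mulVec_le_setNorm hS hw u

theorem norm_le_orbitNorm_of_one_mem (hS : IsBoundedSet S) (h1 : 1 ∈ S) (u : Fin d → ℂ) :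
    ‖WithLp.toLp 2 u‖ ≤ orbitNorm S u := by
  simpa using norm_le_orbitNorm hS h1 u

theorem orbitNorm_one (u : Fin d → ℂ) :
    orbitNorm (1 : Set (Matrix (Fin d) (Fin d) ℂ)) u = ‖WithLp.toLp 2 u‖ := by
  simp [orbitNorm]

theorem orbitNorm_smul_le (hS : IsBoundedSet S) (c : ℂ) (u : Fin d → ℂ) :
    orbitNorm S (c • u) ≤ ‖c‖ * orbitNorm S u := by
  refine orbitNorm_le (mul_nonneg (norm_nonneg _) (orbitNorm_nonneg S u)) fun w hw => ?_
  rw [mulVec_smul, WithLp.toLp_smul, norm_smul]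
  exact mul_le_mul_of_nonneg_left (norm_le_orbitNorm hS hw u) (norm_nonneg _)

theorem orbitNorm_pow_conjTranspose_mulVec_le (hS : IsBoundedSet S)
    {s : Matrix (Fin d) (Fin d) ℂ} (hs : s ∈ S) (n : ℕ) (u : Fin d → ℂ) :
    orbitNorm (S ^ n) (sᴴ *ᵥ u) ≤ orbitNorm (S ^ (n + 1)) u := by
  refine orbitNorm_le (orbitNorm_nonneg _ _) fun w hw => ?_
  rw [mulVec_mulVec, ← conjTranspose_mul]
  refine norm_le_orbitNorm (hS.pow _) ?_ u
  rw [pow_succ']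
  exact Set.mul_mem_mul hs hw

theorem continuous_orbitNorm (hS : IsBoundedSet S) : Continuous (orbitNorm S) := by
  have h : LipschitzWith (setNorm S).toNNReal
      fun u : EuclideanSpace ℂ (Fin d) => orbitNorm S u.ofLp := by
    refine LipschitzWith.of_le_add_mul _ fun u v => ?_
    rw [Real.coe_toNNReal _ (setNorm_nonneg S), dist_eq_norm]
    refine orbitNorm_le (add_nonneg (orbitNorm_nonneg S _)
      (mul_nonneg (setNorm_nonneg S) (norm_nonneg _))) fun w hw => ?_
    have : WithLp.toLp 2 (wᴴ *ᵥ u.ofLp) =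
        WithLp.toLp 2 (wᴴ *ᵥ v.ofLp) + WithLp.toLp 2 (wᴴ *ᵥ (u - v).ofLp) := by
      rw [← WithLp.toLp_add, ← mulVec_add, WithLp.ofLp_sub, add_sub_cancel]
    rw [this]
    exact (norm_add_le _ _).trans (add_le_add (norm_le_orbitNorm hS hw _)
      (norm_conjTranspose_mulVec_le_setNorm hS hw _))
  exact h.continuous.comp (PiLp.continuous_toLp 2 _)

/-- The product of the first `n` orbit norms of the powers of `S`. -/
noncomputable def orbitNormProd (S : Set (Matrix (Fin d) (Fin d) ℂ)) (n : ℕ) (u : Fin d → ℂ) : ℝ :=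
  ∏ l ∈ Finset.range n, orbitNorm (S ^ l) u

/-- Telescoping: the shifted product gains the factor of index `n` and loses that of index `0`,
which is `‖u‖`. Their ratio is at most `‖S ^ n‖`. -/
theorem orbitNormProd_conjTranspose_mulVec_le (hS : IsBoundedSet S)
    {s : Matrix (Fin d) (Fin d) ℂ} (hs : s ∈ S) (n : ℕ) (u : Fin d → ℂ) (hu : u ≠ 0) :
    orbitNormProd S n (sᴴ *ᵥ u) ≤ setNorm (S ^ n) * orbitNormProd S n u := by
  have hpos : 0 < ‖WithLp.toLp 2 u‖ := norm_pos_iff.2 (by simpa using hu)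
  refine le_of_mul_le_mul_right ?_ hpos
  calc orbitNormProd S n (sᴴ *ᵥ u) * ‖WithLp.toLp 2 u‖
      ≤ (∏ l ∈ Finset.range n, orbitNorm (S ^ (l + 1)) u) * orbitNorm (S ^ 0) u := by
        rw [pow_zero, orbitNorm_one]
        exact mul_le_mul_of_nonneg_right (Finset.prod_le_prod (fun l _ => orbitNorm_nonneg _ _)
          fun l _ => orbitNorm_pow_conjTranspose_mulVec_le hS hs l u) hpos.le
    _ = orbitNormProd S n u * orbitNorm (S ^ n) u := by
        rw [← Finset.prod_range_succ' (fun l => orbitNorm (S ^ l) u), Finset.prod_range_succ,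
          orbitNormProd]
    _ ≤ orbitNormProd S n u * (setNorm (S ^ n) * ‖WithLp.toLp 2 u‖) :=
        mul_le_mul_of_nonneg_left (orbitNorm_le_setNorm (hS.pow n) u)
          (Finset.prod_nonneg fun l _ => orbitNorm_nonneg _ _)
    _ = _ := by ring

theorem orbitNormProd_smul_le (hS : IsBoundedSet S) (n : ℕ) (c : ℂ) (u : Fin d → ℂ) :
    orbitNormProd S n (c • u) ≤ ‖c‖ ^ n * orbitNormProd S n u := by
  have h := Finset.prod_le_prod (s := Finset.range n) (fun l _ => orbitNorm_nonneg (S ^ l) (c • u))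
    fun l _ => orbitNorm_smul_le (hS.pow l) c u
  rwa [Finset.prod_mul_distrib, Finset.prod_const, Finset.card_range] at h

theorem continuous_orbitNormProd (hS : IsBoundedSet S) (n : ℕ) :
    Continuous (orbitNormProd S n) :=
  continuous_finsetProd _ fun l _ => continuous_orbitNorm (hS.pow l)

theorem norm_pow_le_orbitNormProd (hS : IsBoundedSet S) (h1 : 1 ∈ S) (n : ℕ) (u : Fin d → ℂ) :
    ‖WithLp.toLp 2 u‖ ^ n ≤ orbitNormProd S n u := by
  have h := Finset.prod_le_prod (s := Finset.range n) (fun _ _ => norm_nonneg (WithLp.toLp 2 u))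
    fun l _ => norm_le_orbitNorm_of_one_mem (hS.pow l) (Set.one_mem_pow h1) u
  rwa [Finset.prod_const, Finset.card_range] at h

/-- A bounded set of matrices of determinant one containing the identity can be conjugated so that
its norm is controlled by that of its `n`-th power. -/
theorem exists_opNorm_conj_le [NeZero d] (hS : IsBoundedSet S) (h1 : 1 ∈ S)
    (hdet : ∀ s ∈ S, s.det = 1) {n : ℕ} (hn : n ≠ 0) :
    ∃ y : GL (Fin d) ℂ, ∀ s ∈ S,
      opNorm (y.1 * s * (y⁻¹).1) ≤ (setNorm (S ^ n) ^ (1 / (n : ℝ))) ^ (d + 1) := by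
  have hcont := continuous_orbitNormProd hS n
  have hD : 0 < setNorm (S ^ n) :=
    zero_lt_one.trans_le (one_le_setNorm (hS.pow n) (Set.one_mem_pow h1))
  set r : ℝ := setNorm (S ^ n) ^ (1 / (n : ℝ)) with hr
  have hr0 : 0 < r := Real.rpow_pos_of_pos hD _
  have hrn : r ^ n = setNorm (S ^ n) := by
    rw [hr, one_div, Real.rpow_inv_natCast_pow hD.le hn]
  -- The region is bounded because `‖u‖ ^ n ≤ F(u)`, and a neighbourhood of `0` because `F` is
  -- continuous with `F(0) ≤ 0`; both use `n ≠ 0`.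
  obtain ⟨y, hy⟩ := exists_norm_conjTranspose_mulVec_le
    (B := {u : Fin d → ℂ | orbitNormProd S n u ≤ 1})
    (isClosed_le hcont continuous_const).measurableSet
    ((Metric.isBounded_closedBall (x := (0 : Fin d → ℂ)) (r := 1)).subset fun u hu => by
      rw [mem_closedBall_zero_iff, pi_norm_le_iff_of_nonneg zero_le_one]
      intro i
      have h : ‖WithLp.toLp 2 u‖ ^ n ≤ 1 := (norm_pow_le_orbitNormProd hS h1 n u).trans hu
      exact (PiLp.norm_apply_le (WithLp.toLp 2 u) i).trans
        ((pow_le_one_iff_of_nonneg (norm_nonneg _) hn).1 h))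
    (by
      have h0 : orbitNormProd S n 0 < 1 := by
        have h := orbitNormProd_smul_le hS n 0 0
        rw [norm_zero, zero_pow hn, zero_mul, smul_zero] at h
        exact h.trans_lt zero_lt_one
      exact (hcont.continuousAt.eventually_lt continuousAt_const h0).mono fun u hu => hu.le)
  refine ⟨y, fun s hs => ?_⟩
  have hdt : ‖(((r⁻¹ : ℝ) : ℂ) • sᴴ).det‖ = r⁻¹ ^ d := by
    rw [det_smul, det_conjTranspose, hdet s hs]
    simp [abs_of_pos hr0]
  -- Applying the moment bound to `sᴴ` controls its adjoint, so it is `s` itself that gets bounded.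
  have key := hy (((r⁻¹ : ℝ) : ℂ) • sᴴ) (by
      rw [← norm_pos_iff, hdt]
      positivity) (fun u hu => by
    by_cases hu0 : u = 0
    · simpa [hu0] using hu
    rw [Set.mem_ofPred_eq, smul_mulVec]
    refine (orbitNormProd_smul_le hS n _ _).trans ?_
    have h2 := (orbitNormProd_conjTranspose_mulVec_le hS hs n u hu0).trans
      (mul_le_of_le_one_right hD.le hu)
    rw [Complex.norm_real, Real.norm_of_nonneg (by positivity), inv_pow, hrn]
    exact (mul_le_mul_of_nonneg_left h2 (by positivity)).trans_eq (inv_mul_cancel₀ hD.ne'))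
  refine opNorm_le_of_norm_mulVec_le (by positivity) fun v => ?_
  -- The exponent `d + 1` collects `r ^ d` from the determinant and one `r` from undoing the
  -- scaling.
  have h := key ((y⁻¹).1 *ᵥ v)
  rw [hdt, conjTranspose_smul, conjTranspose_conjTranspose, smul_mulVec, mulVec_smul,
    WithLp.toLp_smul, norm_smul, norm_star, Complex.norm_real, Real.norm_of_nonneg (by positivity),
    mulVec_mulVec, mulVec_mulVec, mulVec_mulVec, ← Units.val_mul, mul_inv_cancel, Units.val_one,
    one_mulVec, inv_pow, inv_inv, inv_mul_le_iff₀ hr0, ← mul_assoc, ← pow_succ'] at h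
  exact h

end OrbitNorm

/-! ### Conjugation, minimal norm, and its growth along powers. -/

section Conjugation

variable {d : ℕ} {k : Type*} [RCLike k]

/-- Conjugation by `x ∈ GL_d(ℂ)`, as a homomorphism from matrices over `k` to complex matrices. -/
noncomputable def conjHom (k : Type*) [RCLike k] (x : GL (Fin d) ℂ) :
    Matrix (Fin d) (Fin d) k →* Matrix (Fin d) (Fin d) ℂ where
  toFun q := x.1 * q.map (toComplex k) * (x⁻¹).1
  map_one' := by simp [Matrix.map_one]
  map_mul' p q := by
    simp only [Matrix.map_mul, mul_assoc, Units.inv_mul_cancel_left]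

theorem conjSet_eq_image (x : GL (Fin d) ℂ) (Q : Set (Matrix (Fin d) (Fin d) k)) :
    conjSet x Q = conjHom k x '' Q := rfl

theorem conjSet_pow (x : GL (Fin d) ℂ) (Q : Set (Matrix (Fin d) (Fin d) k)) (n : ℕ) :
    conjSet x (Q ^ n) = conjSet x Q ^ n := by
  rw [conjSet_eq_image, conjSet_eq_image, Set.image_pow]

theorem conjSet_mono (x : GL (Fin d) ℂ) {Q T : Set (Matrix (Fin d) (Fin d) k)} (h : Q ⊆ T) :
    conjSet x Q ⊆ conjSet x T :=
  Set.image_mono h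

theorem one_mem_conjSet (x : GL (Fin d) ℂ) {Q : Set (Matrix (Fin d) (Fin d) k)} (h : 1 ∈ Q) :
    1 ∈ conjSet x Q :=
  ⟨1, h, map_one (conjHom k x)⟩

theorem conjHom_conjHom (x y : GL (Fin d) ℂ) (q : Matrix (Fin d) (Fin d) k) :
    conjHom k (y * x) q = y.1 * conjHom k x q * (y⁻¹).1 := by
  simp [conjHom, mul_assoc]

theorem det_conjHom (x : GL (Fin d) ℂ) {q : Matrix (Fin d) (Fin d) k} (hq : q.det = 1) :
    (conjHom k x q).det = 1 := by
  have h : (q.map (toComplex k)).det = 1 := by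
    rw [← RingHom.mapMatrix_apply, ← RingHom.map_det, hq, map_one]
  have hx : x.1.det * (x⁻¹).1.det = 1 := by rw [← det_mul, Units.mul_inv, det_one]
  change (x.1 * q.map (toComplex k) * (x⁻¹).1).det = 1
  rw [det_mul, det_mul, h, mul_one, hx]

theorem opNorm_conjHom_le (x : GL (Fin d) ℂ) (q : Matrix (Fin d) (Fin d) k) :
    opNorm (conjHom k x q) ≤ opNorm x.1 * opNorm (q.map (toComplex k)) * opNorm (x⁻¹).1 :=
  (opNorm_mul_le _ _).trans
    (mul_le_mul_of_nonneg_right (opNorm_mul_le _ _) (opNorm_nonneg _))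

theorem opNorm_map_le_conjHom (x : GL (Fin d) ℂ) (q : Matrix (Fin d) (Fin d) k) :
    opNorm (q.map (toComplex k)) ≤ opNorm (x⁻¹).1 * opNorm (conjHom k x q) * opNorm x.1 := by
  have h : q.map (toComplex k) = (x⁻¹).1 * conjHom k x q * x.1 := by
    simp [conjHom, mul_assoc]
  calc opNorm (q.map (toComplex k)) = opNorm ((x⁻¹).1 * conjHom k x q * x.1) := by rw [← h]
    _ ≤ _ := (opNorm_mul_le _ _).trans
      (mul_le_mul_of_nonneg_right (opNorm_mul_le _ _) (opNorm_nonneg _))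

theorem IsBoundedSet.conjSet {Q : Set (Matrix (Fin d) (Fin d) k)} (hQ : IsBoundedSet Q)
    (x : GL (Fin d) ℂ) : IsBoundedSet (conjSet x Q) := by
  refine .of_le (C := opNorm x.1 * ((d : ℝ) ^ 2 * setNorm Q) * opNorm (x⁻¹).1) ?_
  rintro _ ⟨q, hq, rfl⟩
  refine (opNorm_conjHom_le x q).trans (mul_le_mul_of_nonneg_right (mul_le_mul_of_nonneg_left
    ((opNorm_map_le q).trans ?_) (opNorm_nonneg _)) (opNorm_nonneg _))
  exact mul_le_mul_of_nonneg_left (opNorm_le_setNorm hQ hq) (by positivity)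

/-- The factor by which conjugation by `x` can decrease the norm of a set of matrices. -/
noncomputable def conjDistortion (x : GL (Fin d) ℂ) : ℝ :=
  (d : ℝ) ^ 2 * (opNorm (x⁻¹).1 * opNorm x.1)

theorem conjDistortion_nonneg (x : GL (Fin d) ℂ) : 0 ≤ conjDistortion x :=
  mul_nonneg (by positivity) (mul_nonneg (opNorm_nonneg _) (opNorm_nonneg _))

/-- The constant depends on `x` but not on `Q`, so it can be applied to all powers of a set at once.
-/
theorem setNorm_le_conjSet {Q : Set (Matrix (Fin d) (Fin d) k)} (hQ : IsBoundedSet Q)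
    (x : GL (Fin d) ℂ) : setNorm Q ≤ conjDistortion x * setNorm (conjSet x Q) := by
  refine setNorm_le (mul_nonneg (conjDistortion_nonneg x) (setNorm_nonneg _)) fun q hq => ?_
  have h : opNorm (conjHom k x q) ≤ setNorm (MinimalNorm.conjSet x Q) :=
    opNorm_le_setNorm (hQ.conjSet x) ⟨q, hq, rfl⟩
  calc opNorm q ≤ (d : ℝ) ^ 2 * (opNorm (x⁻¹).1 * opNorm (conjHom k x q) * opNorm x.1) :=
        (opNorm_le_map q).trans
          (mul_le_mul_of_nonneg_left (opNorm_map_le_conjHom x q) (by positivity))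
    _ = conjDistortion x * opNorm (conjHom k x q) := by rw [conjDistortion]; ring
    _ ≤ _ := mul_le_mul_of_nonneg_left h (conjDistortion_nonneg x)

theorem minimalNorm_le (Q : Set (Matrix (Fin d) (Fin d) k)) (x : GL (Fin d) ℂ) :
    minimalNorm Q ≤ setNorm (conjSet x Q) :=
  ciInf_le ⟨0, by rintro _ ⟨x, rfl⟩; exact setNorm_nonneg _⟩ x

theorem minimalNorm_le_setNorm {Q : Set (Matrix (Fin d) (Fin d) k)} (hQ : IsBoundedSet Q) :
    minimalNorm Q ≤ (d : ℝ) ^ 2 * setNorm Q := by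
  refine (minimalNorm_le Q 1).trans
    (setNorm_le (mul_nonneg (by positivity) (setNorm_nonneg _)) ?_)
  rintro _ ⟨q, hq, rfl⟩
  simp only [inv_one, Units.val_one, one_mul, mul_one]
  exact (opNorm_map_le q).trans
    (mul_le_mul_of_nonneg_left (opNorm_le_setNorm hQ hq) (by positivity))

theorem minimalNorm_mono {Q T : Set (Matrix (Fin d) (Fin d) k)} (hT : IsBoundedSet T)
    (h : Q ⊆ T) : minimalNorm Q ≤ minimalNorm T :=
  le_ciInf fun x => (minimalNorm_le Q x).trans (setNorm_mono (hT.conjSet x) (conjSet_mono x h))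

theorem one_le_minimalNorm [NeZero d] {Q : Set (Matrix (Fin d) (Fin d) k)} (hQ : IsBoundedSet Q)
    (h1 : 1 ∈ Q) : 1 ≤ minimalNorm Q :=
  le_ciInf fun x => one_le_setNorm (hQ.conjSet x) (one_mem_conjSet x h1)

/-- Linear growth of the logarithm of the minimal norm along powers. -/
theorem minimalNorm_rpow_le_minimalNorm_pow [NeZero d] {Q : Set (Matrix (Fin d) (Fin d) k)}
    (hdet : ∀ q ∈ Q, q.det = 1) (hQ : IsBoundedSet Q) (h1 : 1 ∈ Q) {n : ℕ} (hn : n ≠ 0) :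
    minimalNorm Q ^ ((n : ℝ) / (d + 1)) ≤ minimalNorm (Q ^ n) := by
  refine le_ciInf fun x => ?_
  rw [conjSet_pow]
  obtain ⟨y, hy⟩ := exists_opNorm_conj_le (hQ.conjSet x) (one_mem_conjSet x h1)
    (by rintro _ ⟨q, hq, rfl⟩; exact det_conjHom x (hdet q hq)) hn
  set D := setNorm (conjSet x Q ^ n)
  have hD : 0 ≤ D := setNorm_nonneg _
  have h : minimalNorm Q ≤ (D ^ (1 / (n : ℝ))) ^ (d + 1) := by
    refine (minimalNorm_le Q (y * x)).trans (setNorm_le (by positivity) ?_)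
    rintro _ ⟨q, hq, rfl⟩
    have := hy (conjHom k x q) ⟨q, hq, rfl⟩
    rwa [← conjHom_conjHom] at this
  have hE := one_le_minimalNorm hQ h1
  refine (Real.rpow_le_rpow (zero_le_one.trans hE) h (by positivity)).trans_eq ?_
  have hn' : (n : ℝ) ≠ 0 := Nat.cast_ne_zero.2 hn
  rw [← Real.rpow_natCast, ← Real.rpow_mul hD, ← Real.rpow_mul hD]
  have : 1 / (n : ℝ) * ((d + 1 : ℕ) : ℝ) * (n / (d + 1)) = 1 := by
    push_cast
    field_simp
  rw [this, Real.rpow_one]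

/-- For `0 < n ≤ 8d` the exponent is at most `1` and `Q ⊆ Q ^ n` suffices. For `n ≥ 8d` the square
root is at most `n / (8d) ≤ n / (d + 1)`, and the linear bound applies. -/
theorem minimalNorm_rpow_sqrt_le_minimalNorm_pow [NeZero d]
    {Q : Set (Matrix (Fin d) (Fin d) k)} (hdet : ∀ q ∈ Q, q.det = 1) (hQ : IsBoundedSet Q)
    (h1 : 1 ∈ Q) (n : ℕ) :
    minimalNorm Q ^ Real.sqrt ((n : ℝ) / (8 * (d : ℝ))) ≤ minimalNorm (Q ^ n) := by
  have hE := one_le_minimalNorm hQ h1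
  have hd : (1 : ℝ) ≤ d := by exact_mod_cast NeZero.one_le
  rcases Nat.eq_zero_or_pos n with rfl | hn
  · simpa using one_le_minimalNorm (hQ.pow 0) (Set.one_mem_pow h1)
  rcases le_total ((n : ℝ) / (8 * d)) 1 with h | h
  · calc minimalNorm Q ^ Real.sqrt ((n : ℝ) / (8 * (d : ℝ)))
        ≤ minimalNorm Q ^ (1 : ℝ) := Real.rpow_le_rpow_of_exponent_le hE (Real.sqrt_le_one.2 h)
      _ = minimalNorm Q := Real.rpow_one _
      _ ≤ _ := minimalNorm_mono (hQ.pow n) (Set.subset_pow h1 hn.ne')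
  · refine (Real.rpow_le_rpow_of_exponent_le hE ?_).trans
      (minimalNorm_rpow_le_minimalNorm_pow hdet hQ h1 hn.ne')
    calc Real.sqrt ((n : ℝ) / (8 * d)) ≤ n / (8 * d) := by
          rw [Real.sqrt_le_left (by positivity)]
          nlinarith
      _ ≤ n / (d + 1) := by gcongr; linarith

end Conjugation

/-! ### Existence of the spectral radius and its comparison with the minimal norm. -/

section SpectralRadius

variable {d : ℕ} {k : Type*} [RCLike k] [NeZero d] {Q : Set (Matrix (Fin d) (Fin d) k)}

/-- Fekete's lemma for `log ‖Q ^ n‖`, which is subadditive, and nonnegative because `1 ∈ Q ^ n`. -/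
theorem tendsto_rootNormSeq (hQ : IsBoundedSet Q) (h1 : 1 ∈ Q) :
    Tendsto (rootNormSeq Q) atTop (𝓝 (jointSpectralRadius Q)) := by
  have hpos : ∀ n, 1 ≤ setNorm (Q ^ n) := fun n =>
    one_le_setNorm (hQ.pow n) (Set.one_mem_pow h1)
  have hsub : Subadditive fun n => Real.log (setNorm (Q ^ n)) := by
    intro m n
    rw [← Real.log_mul (zero_lt_one.trans_le (hpos m)).ne' (zero_lt_one.trans_le (hpos n)).ne']
    refine Real.log_le_log (zero_lt_one.trans_le (hpos _)) ?_
    rw [pow_add]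
    exact setNorm_mul_le (hQ.pow m) (hQ.pow n)
  have h := hsub.tendsto_lim ⟨0, by
    rintro _ ⟨n, rfl⟩
    exact div_nonneg (Real.log_nonneg (hpos n)) n.cast_nonneg⟩
  refine tendsto_nhds_limUnder ⟨_, (Real.continuous_exp.tendsto _ |>.comp h).congr fun n => ?_⟩
  rw [rootNormSeq, Real.rpow_def_of_pos (zero_lt_one.trans_le (hpos n)), mul_one_div]
  rfl

theorem tendsto_const_rpow_one_div {C : ℝ} (hC : 0 < C) :
    Tendsto (fun n : ℕ => C ^ (1 / (n : ℝ))) atTop (𝓝 1) := by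
  have h := (Real.continuousAt_const_rpow (b := 0) hC.ne').tendsto.comp
    tendsto_one_div_atTop_nhds_zero_nat
  rwa [Real.rpow_zero] at h

theorem one_le_jointSpectralRadius (hQ : IsBoundedSet Q) (h1 : 1 ∈ Q) :
    1 ≤ jointSpectralRadius Q :=
  ge_of_tendsto' (tendsto_rootNormSeq hQ h1) fun n =>
    Real.one_le_rpow (one_le_setNorm (hQ.pow n) (Set.one_mem_pow h1)) (by positivity)

/-- For each `x`, `‖Q ^ n‖` is at most a constant times `‖x Q x⁻¹‖ ^ n`; take `n`-th roots, let `n →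
∞`, then take the infimum over `x`. -/
theorem jointSpectralRadius_le_minimalNorm (hQ : IsBoundedSet Q) (h1 : 1 ∈ Q) :
    jointSpectralRadius Q ≤ minimalNorm Q := by
  refine le_ciInf fun x => ?_
  set E := setNorm (conjSet x Q)
  have hE : 0 ≤ E := setNorm_nonneg _
  have hC : 0 < conjDistortion x := by
    have h := (one_le_setNorm hQ h1).trans (setNorm_le_conjSet hQ x)
    exact pos_of_mul_pos_left (zero_lt_one.trans_le h) hE
  have hlim := (tendsto_const_rpow_one_div hC).mul_const E
  rw [one_mul] at hlim
  refine le_of_tendsto_of_tendsto (tendsto_rootNormSeq hQ h1) hlim ?_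
  filter_upwards [eventually_ne_atTop 0] with n hn
  calc rootNormSeq Q n ≤ (conjDistortion x * E ^ n) ^ (1 / (n : ℝ)) := by
        refine Real.rpow_le_rpow (setNorm_nonneg _) ?_ (by positivity)
        refine (setNorm_le_conjSet (hQ.pow n) x).trans (mul_le_mul_of_nonneg_left ?_ hC.le)
        rw [conjSet_pow]
        exact setNorm_pow_le (hQ.conjSet x) n
    _ = conjDistortion x ^ (1 / (n : ℝ)) * E := by
        rw [Real.mul_rpow hC.le (by positivity), one_div, Real.pow_rpow_inv_natCast hE hn]

theorem minimalNorm_rpow_le_jointSpectralRadius (hdet : ∀ q ∈ Q, q.det = 1)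
    (hQ : IsBoundedSet Q) (h1 : 1 ∈ Q) :
    minimalNorm Q ^ (1 / ((d : ℝ) + 1)) ≤ jointSpectralRadius Q := by
  have hd : (0 : ℝ) < (d : ℝ) ^ 2 := by
    have : (0 : ℝ) < d := by exact_mod_cast NeZero.pos d
    positivity
  have hE : 0 ≤ minimalNorm Q := zero_le_one.trans (one_le_minimalNorm hQ h1)
  have hlim := (tendsto_const_rpow_one_div hd).mul (tendsto_rootNormSeq hQ h1)
  rw [one_mul] at hlim
  refine ge_of_tendsto hlim ?_
  filter_upwards [eventually_ne_atTop 0] with n hn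
  have h := Real.rpow_le_rpow (by positivity) ((minimalNorm_rpow_le_minimalNorm_pow hdet hQ h1
    hn).trans (minimalNorm_le_setNorm (hQ.pow n))) (show (0 : ℝ) ≤ 1 / n by positivity)
  rw [← Real.rpow_mul hE, Real.mul_rpow hd.le (setNorm_nonneg _)] at h
  have hn' : (n : ℝ) ≠ 0 := Nat.cast_ne_zero.2 hn
  have he : (n : ℝ) / (d + 1) * (1 / n) = 1 / (d + 1) := by field_simp
  rwa [he] at h

theorem log_minimalNorm_le (hdet : ∀ q ∈ Q, q.det = 1) (hQ : IsBoundedSet Q) (h1 : 1 ∈ Q) :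
    1 / ((d : ℝ) + 1) * Real.log (minimalNorm Q) ≤ Real.log (jointSpectralRadius Q) := by
  have hE : 0 < minimalNorm Q := zero_lt_one.trans_le (one_le_minimalNorm hQ h1)
  rw [← Real.log_rpow hE]
  exact Real.log_le_log (by positivity) (minimalNorm_rpow_le_jointSpectralRadius hdet hQ h1)

end SpectralRadius

end MinimalNorm

theorem mainTheorem10 (d : ℕ) (hd : 1 ≤ d) :
    ∃ c₁ : ℝ, 0 < c₁ ∧
      ∀ (k : Type*) [RCLike k] (Q : Set (Matrix (Fin d) (Fin d) k)),
        (∀ q ∈ Q, q.det = 1) → MinimalNorm.IsBoundedSet Q → 1 ∈ Q →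
          (∀ n : ℕ, MinimalNorm.minimalNorm (Q ^ n) ≥
            MinimalNorm.minimalNorm Q ^ Real.sqrt ((n : ℝ) / (8 * (d : ℝ)))) ∧
          Filter.Tendsto (MinimalNorm.rootNormSeq Q) Filter.atTop
            (nhds (MinimalNorm.jointSpectralRadius Q)) ∧
          Real.log (MinimalNorm.jointSpectralRadius Q) ≥
            c₁ * Real.log (MinimalNorm.minimalNorm Q) *
              min 1 (Real.log (MinimalNorm.minimalNorm Q)) ∧
          (MinimalNorm.jointSpectralRadius Q = 1 ↔ MinimalNorm.minimalNorm Q = 1) := by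
  have : NeZero d := ⟨by lia⟩
  -- The bound proved is `log R ≥ log E / (d + 1)`; the factor `min 1 (log E)` only weakens it.
  refine ⟨1 / ((d : ℝ) + 1), by positivity, fun k _ Q hdet hQ h1 => ?_⟩
  have hE := MinimalNorm.one_le_minimalNorm hQ h1
  have hlogE : 0 ≤ Real.log (MinimalNorm.minimalNorm Q) := Real.log_nonneg hE
  have hlog := MinimalNorm.log_minimalNorm_le hdet hQ h1
  refine ⟨MinimalNorm.minimalNorm_rpow_sqrt_le_minimalNorm_pow hdet hQ h1,
    MinimalNorm.tendsto_rootNormSeq hQ h1,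
    (mul_le_of_le_one_right (by positivity) (min_le_left _ _)).trans hlog, fun hR => ?_,
    fun h => le_antisymm ((MinimalNorm.jointSpectralRadius_le_minimalNorm hQ h1).trans_eq h)
      (MinimalNorm.one_le_jointSpectralRadius hQ h1)⟩
  rw [hR, Real.log_one] at hlog
  have h0 : Real.log (MinimalNorm.minimalNorm Q) ≤ 0 :=
    nonpos_of_mul_nonpos_right hlog (by positivity)
  exact le_antisymm ((Real.log_nonpos_iff (zero_le_one.trans hE)).1 h0) hE
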